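/- Let $n = 2m$ with $m \ge 1$, and let $k \in \{1,\dots,n+1\}$. Then the Manturov–Nikonov map $$\rho\circ f_1\circ p_k:\ PB_{n+1}\xrightarrow{\ p_k\ } CPB_n\xrightarrow{\ f_1\ } VCB_n\xrightarrow{\ \rho\ } GL_n(\mathbb Z[t^{\pm1},s^{\pm1}])$$ is not faithful, i.e. it is not injective. Here braid words are read from left to right in time, and: * $PB_{n+1}$ is the pure braid group, the kernel of $B_{n+1}\to S_{n+1}$, where $B_{n+1}$ is generated by $\sigma_1,\dots,\sigma_n$ with Artin's relations. * $CB_n$ is the cylindrical (annular) braid group on $n$ strands, generated by $\sigma_1,\dots,\sigma_{n-1}$ and the rotation $\zeta$ with Artin's relations, $\sigma_i\zeta=\zeta\sigma_{i+1}$ for $1\le i\le n-2$, and $\sigma_{n-1}\zeta^2=\zeta^2\sigma_1$; $CPB_n$ is the kernel of $CB_n\to S_n$, where $\sigma_i$ maps to a transposition of neighbours and $\zeta$ to an $n$-cycle. * $VCB_n$ is the virtual cylindrical braid group, generated by $\sigma_i,\tau_i$ $(1\le i\le n-1)$ and $\zeta$ with the above relations for $\sigma_i,\zeta$, the same relations for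 $\tau_i,\zeta$, and $\tau_i^2=1$, $\tau_i\tau_{i+1}\sigma_i=\sigma_{i+1}\tau_i\tau_{i+1}$, $\sigma_i\tau_j=\tau_j\sigma_i$ for $|i-j|\ge2$. * $p_k$ sends a pure braid $(\beta_l)_l$ to the cylindrical braid $\big((\beta_l-\beta_k)/|\beta_l-\beta_k|\big)_{l\ne k}$. On a word it is computed letter by letter, following the strand that starts at position $k$: when this strand is at position $j$, the letter $\sigma_i^{\epsilon}$, $\epsilon=\pm1$, contributes $\sigma_{j-i-1}^{\epsilon}$ if $i<j-1$, $\sigma_{n+j-i}^{\epsilon}$ if $i>j$, $\zeta^{-1}$ if $i=j-1,\epsilon=1$, $\Delta_c$ if $i=j-1,\epsilon=-1$, $\Delta_c^{-1}$ if $i=j,\epsilon=1$, and $\zeta$ if $i=j,\epsilon=-1$, where $\Delta_c=\sigma_1\cdots\sigma_{n-1}$. * $f_d$ is the restriction to $CPB_n$ of the homomorphism $CB_n\to VCB_n$, $\sigma_i\mapsto\sigma_i$, $\zeta\mapsto\zeta(\Delta_v\zeta)^{d-1}$ with $\Delta_v=\tau_1\cdots\tau_{n-1}$; so $f_1$ is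 $\sigma_i\mapsto\sigma_i$, $\zeta\mapsto\zeta$. * $\rho(\sigma_i)=I_{i-1}\oplus\begin{pmatrix}1-t&t\\1&0\end{pmatrix}\oplus I_{n-i-1}$, $\rho(\tau_i)=I_{i-1}\oplus\begin{pmatrix}0&s\\s^{-1}&0\end{pmatrix}\oplus I_{n-i-1}$, $\rho(\zeta)=\begin{pmatrix}0&I_{n-1}\\1&0\end{pmatrix}$. -/

import Mathlib

/-!
Conventions.  Braid words are read from left to right (the leftmost letter comes first in time),
strand positions and generators are numbered from `0`, so that `σ i` exchanges the positions
`i` and `i + 1`.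
-/

namespace ManturovNikonov

open Equiv

/-! ### Groups given by generators and relations `a = b` -/

/-- The group generated by `α` subject to the relations `a = b` for `r a b`. -/
abbrev PresentedBy {α : Type} (r : FreeGroup α → FreeGroup α → Prop) : Type :=
  PresentedGroup {x : FreeGroup α | ∃ a b, r a b ∧ x = a * b⁻¹}

theorem PresentedBy.eq_of_rel {α : Type} {r : FreeGroup α → FreeGroup α → Prop}
    {a b : FreeGroup α} (h : r a b) :
    FreeGroup.lift (fun x => (PresentedGroup.of x : PresentedBy r)) a =
      FreeGroup.lift (fun x => (PresentedGroup.of x : PresentedBy r)) b := by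
  have key : FreeGroup.lift (fun x => (PresentedGroup.of x : PresentedBy r)) =
      PresentedGroup.mk {x : FreeGroup α | ∃ a b, r a b ∧ x = a * b⁻¹} := by
    ext x; simp [PresentedGroup.of]
  rw [key, ← mul_inv_eq_one, ← map_inv, ← map_mul]
  exact (QuotientGroup.eq_one_iff _).2 (Subgroup.subset_normalClosure ⟨a, b, h, rfl⟩)

/-- The homomorphism defined by images of the generators that satisfy the relations. -/
def PresentedBy.lift {α : Type} {r : FreeGroup α → FreeGroup α → Prop} {G : Type*} [Group G]
    (f : α → G) (h : ∀ a b, r a b → FreeGroup.lift f a = FreeGroup.lift f b) :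
    PresentedBy r →* G :=
  PresentedGroup.toGroup (f := f) (by
    rintro x ⟨a, b, hab, rfl⟩
    rw [map_mul, map_inv, h a b hab, mul_inv_cancel])

theorem PresentedBy.lift_of {α : Type} {r : FreeGroup α → FreeGroup α → Prop} {G : Type*}
    [Group G] (f : α → G) (h : ∀ a b, r a b → FreeGroup.lift f a = FreeGroup.lift f b) (x : α) :
    PresentedBy.lift f h (PresentedGroup.of x) = f x :=
  PresentedGroup.toGroup.of _

/-! ### Sequences satisfying the braid relations -/

/-- `s 0, …, s (N - 1)` satisfy the braid relations. -/
structure IsBraided {G : Type*} [Group G] (N : ℕ) (s : ℕ → G) : Prop where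
  braid : ∀ i, i + 1 < N → s i * s (i + 1) * s i = s (i + 1) * s i * s (i + 1)
  comm : ∀ i j, i + 2 ≤ j → j < N → s i * s j = s j * s i

/-- The product `s 0 * s 1 * ⋯ * s (j - 1)`. -/
def prodTo {G : Type*} [Group G] (s : ℕ → G) (j : ℕ) : G := ((List.range j).map s).prod

theorem prodTo_succ {G : Type*} [Group G] (s : ℕ → G) (j : ℕ) :
    prodTo s (j + 1) = prodTo s j * s j := by
  simp [prodTo, List.range_succ]

theorem prodTo_succ' {G : Type*} [Group G] (s : ℕ → G) (j : ℕ) :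
    prodTo s (j + 1) = s 0 * prodTo (fun i => s (i + 1)) j := by
  simp [prodTo, List.range_succ_eq_map, Function.comp_def]

theorem prodTo_comm {G : Type*} [Group G] (s : ℕ → G) (j : ℕ) (x : G)
    (h : ∀ i < j, s i * x = x * s i) : prodTo s j * x = x * prodTo s j := by
  induction j with
  | zero => simp [prodTo]
  | succ j ih =>
    rw [prodTo_succ, mul_assoc, h j (by omega), ← mul_assoc, ih (fun i hi => h i (by omega)),
      mul_assoc]

theorem prodTo_map {G H : Type*} [Group G] [Group H] (f : G →* H) (s : ℕ → G) (j : ℕ) :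
    f (prodTo s j) = prodTo (fun i => f (s i)) j := by
  simp [prodTo, map_list_prod, Function.comp_def]

theorem prodTo_shift {G : Type*} [Group G] (s s' : ℕ → G) (x : G) (j : ℕ)
    (h : ∀ i < j, x * s i = s' i * x) : x * prodTo s j = prodTo s' j * x := by
  induction j with
  | zero => simp [prodTo]
  | succ j ih =>
    rw [prodTo_succ, prodTo_succ, ← mul_assoc, ih (fun i hi => h i (by omega)), mul_assoc,
      h j (by omega), mul_assoc]

theorem IsBraided.prodTo_mul {G : Type*} [Group G] {N : ℕ} {s : ℕ → G} (hs : IsBraided N s)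
    (j : ℕ) (hj : j ≤ N) (i : ℕ) (hi : i + 1 < j) :
    prodTo s j * s i = s (i + 1) * prodTo s j := by
  induction j with
  | zero => omega
  | succ j ih =>
    rcases Nat.lt_or_ge (i + 1) j with h | h
    · rw [prodTo_succ, mul_assoc, ← hs.comm i j (by omega) (by omega), ← mul_assoc,
        ih (by omega) h, mul_assoc]
    · obtain rfl : j = i + 1 := by omega
      rw [prodTo_succ, prodTo_succ, mul_assoc, mul_assoc, ← mul_assoc (s i),
        hs.braid i (by omega), ← mul_assoc, ← mul_assoc, ← mul_assoc,
        prodTo_comm s i (s (i + 1)) (fun l hl => hs.comm l (i + 1) (by omega) (by omega))]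
      simp only [mul_assoc]

theorem IsBraided.prodTo_sq {G : Type*} [Group G] {N : ℕ} {s : ℕ → G} (hs : IsBraided N s)
    (j : ℕ) (hj : j < N) :
    prodTo s (j + 1) * prodTo s (j + 1) * s j = s 0 * (prodTo s (j + 1) * prodTo s (j + 1)) := by
  have h1 : prodTo s (j + 1) * prodTo s j = prodTo (fun i => s (i + 1)) j * prodTo s (j + 1) :=
    prodTo_shift _ _ _ _ (fun i hi => hs.prodTo_mul (j + 1) (by omega) i (by omega))
  calc prodTo s (j + 1) * prodTo s (j + 1) * s j
      = (s 0 * prodTo (fun i => s (i + 1)) j) * prodTo s (j + 1) * s j := by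
        rw [← prodTo_succ']
    _ = s 0 * (prodTo s (j + 1) * prodTo s j * s j) := by rw [h1]; simp only [mul_assoc]
    _ = s 0 * (prodTo s (j + 1) * prodTo s (j + 1)) := by
        rw [mul_assoc _ (prodTo s j), ← prodTo_succ]

/-! ### The braid group and the pure braid group -/

/-- Artin's relations between the generators `σ 0, …, σ (N - 2)`. -/
inductive BraidRel (N : ℕ) : FreeGroup (Fin (N - 1)) → FreeGroup (Fin (N - 1)) → Prop
  | braid (i j : Fin (N - 1)) (h : i.val + 1 = j.val) :
      BraidRel N (.of i * .of j * .of i) (.of j * .of i * .of j)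
  | comm (i j : Fin (N - 1)) (h : i.val + 2 ≤ j.val) :
      BraidRel N (.of i * .of j) (.of j * .of i)

/-- The braid group `B_N` on `N` strands. -/
abbrev BraidGroup (N : ℕ) : Type := PresentedBy (BraidRel N)

/-- The homomorphism from `B_N` given by a braided sequence. -/
def BraidGroup.lift {G : Type*} [Group G] (N : ℕ) (s : ℕ → G) (hs : IsBraided (N - 1) s) :
    BraidGroup N →* G :=
  PresentedBy.lift (fun i => s i.val) (by
    intro a b hab
    cases hab with
    | braid i j h => simpa [← h] using hs.braid i.val (by omega)
    | comm i j h => simpa using hs.comm i.val j.val h j.isLt)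

/-- The transposition of `i` and `i + 1` in `{0, …, N - 1}` (the identity if out of range). -/
def adjSwap (N i : ℕ) : Perm (Fin N) :=
  if h : i + 1 < N then swap ⟨i, by omega⟩ ⟨i + 1, h⟩ else 1

/-- The transposition of `i` and `i + 1` on natural numbers. -/
def swapNat (i k : ℕ) : ℕ := if k = i then i + 1 else if k = i + 1 then i else k

theorem adjSwap_val (N i : ℕ) (h : i + 1 < N) (k : Fin N) :
    (adjSwap N i k).val = swapNat i k.val := by
  simp only [adjSwap, dif_pos h, swapNat, swap_apply_def, Fin.ext_iff]
  split_ifs <;> simp_all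

theorem adjSwap_inv (N i : ℕ) : (adjSwap N i)⁻¹ = adjSwap N i := by
  unfold adjSwap; split_ifs <;> simp

theorem adjSwap_braided (N : ℕ) : IsBraided (N - 1) (adjSwap N) where
  braid i h := by
    ext k
    simp only [Perm.mul_apply]
    repeat rw [adjSwap_val _ _ (by omega)]
    simp only [swapNat]; split_ifs <;> omega
  comm i j h hj := by
    ext k
    simp only [Perm.mul_apply]
    repeat rw [adjSwap_val _ _ (by omega)]
    simp only [swapNat]; split_ifs <;> omega

/-- The permutation of a braid; the strand that starts at position `k` ends at position
`(braidPerm N β)⁻¹ k`. -/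
def braidPerm (N : ℕ) : BraidGroup N →* Perm (Fin N) :=
  BraidGroup.lift N (adjSwap N) (adjSwap_braided N)

/-- The pure braid group `PB_N`. -/
def PureBraidGroup (N : ℕ) : Subgroup (BraidGroup N) := (braidPerm N).ker

/-! ### The cylindrical braid group -/

/-- Generators of the cylindrical braid group: the crossings `σ i` and the rotation `ζ`, which
moves every position `a < n - 1` to `a + 1` and the last position through the cut to `0`. -/
inductive CylGen (n : ℕ) : Type
  | σ (i : Fin (n - 1))
  | ζ

/-- Relations of the cylindrical braid group. -/
inductive CylRel (n : ℕ) : FreeGroup (CylGen n) → FreeGroup (CylGen n) → Prop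
  | braid (i j : Fin (n - 1)) (h : i.val + 1 = j.val) :
      CylRel n (.of (.σ i) * .of (.σ j) * .of (.σ i)) (.of (.σ j) * .of (.σ i) * .of (.σ j))
  | comm (i j : Fin (n - 1)) (h : i.val + 2 ≤ j.val) :
      CylRel n (.of (.σ i) * .of (.σ j)) (.of (.σ j) * .of (.σ i))
  | rot (i j : Fin (n - 1)) (h : i.val + 1 = j.val) :
      CylRel n (.of (.σ i) * .of .ζ) (.of .ζ * .of (.σ j))
  | wrap (i j : Fin (n - 1)) (hi : i.val + 2 = n) (hj : j.val = 0) :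
      CylRel n (.of (.σ i) * (.of .ζ * .of .ζ)) ((.of .ζ * .of .ζ) * .of (.σ j))

/-- The cylindrical braid group `CB_n` on `n` strands. -/
abbrev CylBraidGroup (n : ℕ) : Type := PresentedBy (CylRel n)

/-- `x 0, …, x (n - 2)` and `z` satisfy the relations between crossings and rotation. -/
structure IsRotated {G : Type*} [Group G] (n : ℕ) (x : ℕ → G) (z : G) : Prop where
  rot : ∀ i, i + 2 < n → x i * z = z * x (i + 1)
  wrap : 2 ≤ n → x (n - 2) * (z * z) = (z * z) * x 0

/-- The homomorphism from `CB_n` given by images of the generators. -/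
def CylBraidGroup.lift {G : Type*} [Group G] (n : ℕ) (x : ℕ → G) (z : G)
    (hx : IsBraided (n - 1) x) (hz : IsRotated n x z) : CylBraidGroup n →* G :=
  PresentedBy.lift (fun | .σ i => x i.val | .ζ => z) (by
    intro a b hab
    cases hab with
    | braid i j h => simpa [← h] using hx.braid i.val (by omega)
    | comm i j h => simpa using hx.comm i.val j.val h j.isLt
    | rot i j h => simpa [← h] using hz.rot i.val (by omega)
    | wrap i j hi hj =>
      have := hz.wrap (by omega)
      rw [show n - 2 = i.val by omega] at this
      simpa [hj] using this)

namespace CylBraidGroup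

/-- The crossing `σ i` in `CB_n` (the identity if `i` is out of range). -/
def σ (n i : ℕ) : CylBraidGroup n :=
  if h : i < n - 1 then PresentedGroup.of (.σ ⟨i, h⟩) else 1

/-- The rotation `ζ` in `CB_n`. -/
def ζ (n : ℕ) : CylBraidGroup n := PresentedGroup.of .ζ

/-- The element `Δ_c`, the product of all crossings `σ i` in increasing order. -/
def Δc (n : ℕ) : CylBraidGroup n := prodTo (σ n) (n - 1)

theorem braided (n : ℕ) : IsBraided (n - 1) (σ n) where
  braid i h := by
    simpa [σ, h, show i < n - 1 by omega] using
      PresentedBy.eq_of_rel (CylRel.braid (n := n) ⟨i, by omega⟩ ⟨i + 1, h⟩ rfl)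
  comm i j h hj := by
    simpa [σ, hj, show i < n - 1 by omega] using
      PresentedBy.eq_of_rel (CylRel.comm (n := n) ⟨i, by omega⟩ ⟨j, hj⟩ h)

theorem rotated (n : ℕ) : IsRotated n (σ n) (ζ n) where
  rot i h := by
    simpa [σ, ζ, show i < n - 1 by omega, show i + 1 < n - 1 by omega] using
      PresentedBy.eq_of_rel (CylRel.rot (n := n) ⟨i, by omega⟩ ⟨i + 1, by omega⟩ rfl)
  wrap h := by
    simpa [σ, ζ, show n - 2 < n - 1 by omega, show 0 < n - 1 by omega] using
      PresentedBy.eq_of_rel (CylRel.wrap (n := n) ⟨n - 2, by omega⟩ ⟨0, by omega⟩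
        (by simp; omega) rfl)

theorem lift_σ {G : Type*} [Group G] (n : ℕ) (x : ℕ → G) (z : G)
    (hx : IsBraided (n - 1) x) (hz : IsRotated n x z) (i : ℕ) (hi : i < n - 1) :
    lift n x z hx hz (σ n i) = x i := by
  simp [σ, hi, lift, PresentedBy.lift_of]

theorem lift_ζ {G : Type*} [Group G] (n : ℕ) (x : ℕ → G) (z : G)
    (hx : IsBraided (n - 1) x) (hz : IsRotated n x z) :
    lift n x z hx hz (ζ n) = z := by
  simp [ζ, lift, PresentedBy.lift_of]

end CylBraidGroup

theorem finRotate_val (n : ℕ) (a : Fin n) :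
    (finRotate n a).val = if a.val + 1 = n then 0 else a.val + 1 := by
  cases n with
  | zero => exact a.elim0
  | succ n =>
    rw [finRotate_apply, Fin.val_add_one]
    simp [Fin.ext_iff]

theorem adjSwap_rotated (n : ℕ) : IsRotated n (adjSwap n) (finRotate n)⁻¹ where
  rot i h := by
    rw [mul_inv_eq_iff_eq_mul, mul_assoc, eq_inv_mul_iff_mul_eq]
    ext k
    simp only [Perm.mul_apply]
    rw [finRotate_val, adjSwap_val _ _ (by omega), adjSwap_val _ _ (by omega), finRotate_val]
    simp only [swapNat]; split_ifs <;> omega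
  wrap h := by
    rw [← mul_inv_rev, mul_inv_eq_iff_eq_mul, mul_assoc, eq_inv_mul_iff_mul_eq]
    ext k
    simp only [Perm.mul_apply]
    have hk := k.isLt
    simp only [finRotate_val, adjSwap_val n (n - 2) (by omega), adjSwap_val n 0 (by omega),
      swapNat]
    grind

/-- The permutation of a cylindrical braid; the strand that starts at position `a` ends at
position `(cylPerm n β)⁻¹ a`. -/
def cylPerm (n : ℕ) : CylBraidGroup n →* Perm (Fin n) :=
  CylBraidGroup.lift n (adjSwap n) (finRotate n)⁻¹ (adjSwap_braided n) (adjSwap_rotated n)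

/-- The pure cylindrical braid group `CPB_n`. -/
def PureCylBraidGroup (n : ℕ) : Subgroup (CylBraidGroup n) := (cylPerm n).ker

/-! ### The map `p_k` -/

/-- The cylindrical braid that the other `n` strands describe around the strand at position `k`
while the crossing `σ i` of `B_{n+1}` takes place: seen from position `k`, the positions
`k - 1, …, 0, n, …, k + 1` are the positions `0, …, n - 1` on the circle. -/
def crossingSeenFrom (n i k : ℕ) : CylBraidGroup n :=
  if i + 1 < k then CylBraidGroup.σ n (k - i - 2)
  else if i + 1 = k then (CylBraidGroup.ζ n)⁻¹
  else if i = k then (CylBraidGroup.Δc n)⁻¹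
  else CylBraidGroup.σ n (n + k - i - 1)

/-- The crossing `σ i` of `B_{n+1}` as seen from all positions, with its permutation. -/
def trackedCrossing (n i : ℕ) :
    (Fin (n + 1) → CylBraidGroup n) ⋊[mulAutArrow] Perm (Fin (n + 1)) :=
  ⟨fun k => crossingSeenFrom n i k.val, adjSwap (n + 1) i⟩

theorem mulAutArrow_perm_apply {A G : Type*} [Group G] (s : Perm A) (F : A → G) (k : A) :
    mulAutArrow s F k = F (s⁻¹ k) := rfl

section crossingSeenFrom

variable {n i k : ℕ}

theorem crossingSeenFrom_left (h : i + 1 < k) :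
    crossingSeenFrom n i k = CylBraidGroup.σ n (k - i - 2) := if_pos h

theorem crossingSeenFrom_pred : crossingSeenFrom n i (i + 1) = (CylBraidGroup.ζ n)⁻¹ := by
  simp [crossingSeenFrom]

theorem crossingSeenFrom_self : crossingSeenFrom n i i = (CylBraidGroup.Δc n)⁻¹ := by
  simp [crossingSeenFrom]

theorem crossingSeenFrom_right (h : k < i) :
    crossingSeenFrom n i k = CylBraidGroup.σ n (n + k - i - 1) := by
  simp [crossingSeenFrom, show ¬ i + 1 < k by omega, show ¬ i + 1 = k by omega,
    show ¬ i = k by omega]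

theorem swapNat_self : swapNat i i = i + 1 := by simp [swapNat]

theorem swapNat_succ : swapNat i (i + 1) = i := by simp [swapNat]

theorem swapNat_of_ne (h : k ≠ i) (h' : k ≠ i + 1) : swapNat i k = k := by simp [swapNat, h, h']

end crossingSeenFrom

theorem crossingSeenFrom_comm (n i j : ℕ) (h : i + 2 ≤ j) (hj : j < n) (k : ℕ)
    (hk : k < n + 1) :
    crossingSeenFrom n i k * crossingSeenFrom n j (swapNat i k) =
      crossingSeenFrom n j k * crossingSeenFrom n i (swapNat j k) := by
  have hb := CylBraidGroup.braided n
  have hr := CylBraidGroup.rotated n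
  have hζ : ∀ a b, a + 2 < n → b = a + 1 → (CylBraidGroup.ζ n)⁻¹ * CylBraidGroup.σ n a =
      CylBraidGroup.σ n b * (CylBraidGroup.ζ n)⁻¹ := by
    rintro a b ha rfl
    rw [inv_mul_eq_iff_eq_mul, ← mul_assoc, eq_mul_inv_iff_mul_eq]
    exact hr.rot a ha
  have hΔ : ∀ a b, a + 2 < n → b = a + 1 → (CylBraidGroup.Δc n)⁻¹ * CylBraidGroup.σ n b =
      CylBraidGroup.σ n a * (CylBraidGroup.Δc n)⁻¹ := by
    rintro a b ha rfl
    rw [inv_mul_eq_iff_eq_mul, ← mul_assoc, eq_mul_inv_iff_mul_eq]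
    exact (hb.prodTo_mul (n - 1) le_rfl a (by omega)).symm
  obtain h1 | rfl | rfl | h1 | rfl | rfl | h1 : k < i ∨ k = i ∨ k = i + 1 ∨ (i + 1 < k ∧ k < j) ∨
      k = j ∨ k = j + 1 ∨ j + 1 < k := by omega
  · rw [swapNat_of_ne (by omega) (by omega), swapNat_of_ne (by omega) (by omega),
      crossingSeenFrom_right (by omega), crossingSeenFrom_right (by omega)]
    exact (hb.comm _ _ (by omega) (by omega)).symm
  · rw [swapNat_self, swapNat_of_ne (by omega) (by omega), crossingSeenFrom_self,
      crossingSeenFrom_right (by omega), crossingSeenFrom_right (by omega)]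
    exact hΔ _ _ (by omega) (by omega)
  · rw [swapNat_succ, swapNat_of_ne (by omega) (by omega), crossingSeenFrom_pred,
      crossingSeenFrom_right (by omega), crossingSeenFrom_right (by omega)]
    exact hζ _ _ (by omega) (by omega)
  · rw [swapNat_of_ne (by omega) (by omega), swapNat_of_ne (by omega) (by omega),
      crossingSeenFrom_left (by omega), crossingSeenFrom_right (by omega)]
    exact hb.comm _ _ (by omega) (by omega)
  · rw [swapNat_self, swapNat_of_ne (by omega) (by omega), crossingSeenFrom_self,
      crossingSeenFrom_left (by omega), crossingSeenFrom_left (by omega)]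
    exact (hΔ _ _ (by omega) (by omega)).symm
  · rw [swapNat_succ, swapNat_of_ne (by omega) (by omega), crossingSeenFrom_pred,
      crossingSeenFrom_left (by omega), crossingSeenFrom_left (by omega)]
    exact (hζ _ _ (by omega) (by omega)).symm
  · rw [swapNat_of_ne (by omega) (by omega), swapNat_of_ne (by omega) (by omega),
      crossingSeenFrom_left (by omega), crossingSeenFrom_left (by omega)]
    exact (hb.comm _ _ (by omega) (by omega)).symm

theorem crossingSeenFrom_braid (n i : ℕ) (h : i + 1 < n) (k : ℕ) (hk : k < n + 1) :
    crossingSeenFrom n i k * crossingSeenFrom n (i + 1) (swapNat i k) *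
        crossingSeenFrom n i (swapNat (i + 1) (swapNat i k)) =
      crossingSeenFrom n (i + 1) k * crossingSeenFrom n i (swapNat (i + 1) k) *
        crossingSeenFrom n (i + 1) (swapNat i (swapNat (i + 1) k)) := by
  have hb := CylBraidGroup.braided n
  have hr := CylBraidGroup.rotated n
  obtain ⟨N, rfl⟩ : ∃ N, n = N + 2 := ⟨n - 2, by omega⟩
  obtain h1 | rfl | rfl | rfl | h1 : k < i ∨ k = i ∨ k = i + 1 ∨ k = i + 1 + 1 ∨ i + 2 < k := by
    omega
  · simp only [swapNat_of_ne (show k ≠ i by omega) (show k ≠ i + 1 by omega),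
      swapNat_of_ne (show k ≠ i + 1 by omega) (show k ≠ i + 1 + 1 by omega)]
    rw [crossingSeenFrom_right (by omega), crossingSeenFrom_right (by omega)]
    have := hb.braid (N + 2 + k - (i + 1) - 1) (by omega)
    rw [show N + 2 + k - (i + 1) - 1 + 1 = N + 2 + k - i - 1 by omega] at this
    exact this.symm
  · have e : N + 2 + k - (k + 1) - 1 = N := by omega
    have e' : k + 1 + 1 - k - 2 = 0 := by omega
    rw [swapNat_self, swapNat_self, swapNat_of_ne (by omega) (by omega), swapNat_self,
      crossingSeenFrom_self, crossingSeenFrom_self, crossingSeenFrom_left (by omega),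
      crossingSeenFrom_right (by omega), e, e']
    have := hb.prodTo_sq N (by omega)
    change CylBraidGroup.Δc (N + 2) * CylBraidGroup.Δc (N + 2) * _ =
      _ * (CylBraidGroup.Δc (N + 2) * CylBraidGroup.Δc (N + 2)) at this
    rw [mul_assoc (CylBraidGroup.σ (N + 2) N), ← mul_inv_rev, inv_mul_eq_iff_eq_mul, ← mul_assoc,
      eq_mul_inv_iff_mul_eq]
    exact this.symm
  · have e : N + 2 + i - (i + 1) - 1 = N := by omega
    have e' : i + 1 + 1 - i - 2 = 0 := by omega
    rw [swapNat_succ, swapNat_self, swapNat_of_ne (by omega) (by omega),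
      swapNat_of_ne (by omega) (by omega), crossingSeenFrom_pred, crossingSeenFrom_self,
      crossingSeenFrom_self, crossingSeenFrom_pred,
      crossingSeenFrom_right (by omega), crossingSeenFrom_left (by omega), e, e']
    have h5 := prodTo_shift (fun a => CylBraidGroup.σ (N + 2) (a + 1)) (CylBraidGroup.σ (N + 2))
      (CylBraidGroup.ζ (N + 2)) N (fun a ha => (hr.rot a (by omega)).symm)
    have h6 : CylBraidGroup.Δc (N + 2) = _ := prodTo_succ (CylBraidGroup.σ (N + 2)) N
    have h7 : CylBraidGroup.Δc (N + 2) = _ := prodTo_succ' (CylBraidGroup.σ (N + 2)) N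
    conv_lhs => rw [h6]
    conv_rhs => rw [h7]
    have h8 := congrArg (fun x => x⁻¹) h5
    simp only [mul_inv_rev] at h8
    simp only [mul_inv_rev, mul_assoc, mul_inv_cancel_left, inv_mul_cancel_left]
    exact h8.symm
  · have e : N + 2 + i - (i + 1) - 1 = N := by omega
    have e' : i + 1 + 1 - i - 2 = 0 := by omega
    rw [swapNat_succ, swapNat_of_ne (by omega) (by omega), swapNat_succ, swapNat_succ,
      crossingSeenFrom_pred, crossingSeenFrom_pred, crossingSeenFrom_left (by omega),
      crossingSeenFrom_right (by omega), e, e']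
    have := hr.wrap (by omega)
    rw [mul_assoc, ← mul_inv_rev, mul_inv_eq_iff_eq_mul, mul_assoc, eq_inv_mul_iff_mul_eq]
    exact this.symm
  · simp only [swapNat_of_ne (show k ≠ i by omega) (show k ≠ i + 1 by omega),
      swapNat_of_ne (show k ≠ i + 1 by omega) (show k ≠ i + 1 + 1 by omega)]
    rw [crossingSeenFrom_left (by omega), crossingSeenFrom_left (by omega)]
    have := hb.braid (k - (i + 1) - 2) (by omega)
    rw [show k - (i + 1) - 2 + 1 = k - i - 2 by omega] at this
    exact this.symm

theorem trackedCrossing_braided (n : ℕ) : IsBraided n (trackedCrossing n) where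
  braid i h := by
    refine SemidirectProduct.ext ?_ ((adjSwap_braided (n + 1)).braid i h)
    funext k
    have := crossingSeenFrom_braid n i h k.val k.isLt
    simp only [← adjSwap_val (n + 1) i (by omega : i + 1 < n + 1),
      ← adjSwap_val (n + 1) (i + 1) (by omega : i + 2 < n + 1)] at this
    simpa only [trackedCrossing, SemidirectProduct.mul_left, SemidirectProduct.mul_right,
      Pi.mul_apply, mulAutArrow_perm_apply, mul_inv_rev, adjSwap_inv, Perm.mul_apply] using this
  comm i j h hj := by
    refine SemidirectProduct.ext ?_ ((adjSwap_braided (n + 1)).comm i j h hj)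
    funext k
    have := crossingSeenFrom_comm n i j h hj k.val k.isLt
    simp only [← adjSwap_val (n + 1) i (by omega : i + 1 < n + 1),
      ← adjSwap_val (n + 1) j (by omega : j + 1 < n + 1)] at this
    simpa only [trackedCrossing, SemidirectProduct.mul_left,
      Pi.mul_apply, mulAutArrow_perm_apply, adjSwap_inv] using this

/-- The homomorphism that records, for a braid on `n + 1` strands and every position `k`, the
cylindrical braid that the other strands describe around the strand starting at `k`.  The
multiplication of the semidirect product makes this strand be followed: the component at `k` of
`β * γ` is the component at `k` of `β` times the component of `γ` at the end position of the
strand of `β` that starts at `k`. -/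
def trackedBraid (n : ℕ) :
    BraidGroup (n + 1) →* (Fin (n + 1) → CylBraidGroup n) ⋊[mulAutArrow] Perm (Fin (n + 1)) :=
  BraidGroup.lift (n + 1) (trackedCrossing n) (trackedCrossing_braided n)

theorem trackedBraid_right (n : ℕ) (β : BraidGroup (n + 1)) :
    (trackedBraid n β).right = braidPerm (n + 1) β := by
  have : SemidirectProduct.rightHom.comp (trackedBraid n) = braidPerm (n + 1) := by
    refine PresentedGroup.ext fun i => ?_
    simp [trackedBraid, braidPerm, BraidGroup.lift, PresentedBy.lift_of, trackedCrossing]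
  exact DFunLike.congr_fun this β

/-- The position on the circle, seen from `k`, of the strand at position `l ≠ k`. -/
def circlePos (n k l : ℕ) : ℕ := if l < k then k - 1 - l else n + k - l

theorem prodTo_adjSwap_val (n j : ℕ) (hj : j < n) (a : Fin n) :
    (prodTo (adjSwap n) j a).val = if a.val = j then 0 else if a.val < j then a.val + 1 else a := by
  induction j generalizing a with
  | zero => simp [prodTo]
  | succ j ih =>
    rw [prodTo_succ, Perm.mul_apply, ih (by omega), adjSwap_val n j hj]
    simp only [swapNat]
    grind

/-- The pairs of a family of cylindrical braids and a permutation that are compatible with the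
positions on the circle. -/
def compatible (n : ℕ) :
    Subgroup ((Fin (n + 1) → CylBraidGroup n) ⋊[mulAutArrow] Perm (Fin (n + 1))) where
  carrier := {x | ∀ (k l : Fin (n + 1)) (a : Fin n), l ≠ k → a.val = circlePos n k l →
    ((cylPerm n (x.left k))⁻¹ a).val = circlePos n (x.right⁻¹ k) (x.right⁻¹ l)}
  one_mem' := by intro k l a _ h; simpa using h
  mul_mem' := by
    intro x y hx hy k l a hl ha
    have h1 := hx k l a hl ha
    have h2 := hy _ _ _ (fun h => hl (x.right⁻¹.injective h)) h1
    simpa only [Set.mem_ofPred_eq, SemidirectProduct.mul_left, SemidirectProduct.mul_right,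
      Pi.mul_apply, mulAutArrow_perm_apply, map_mul, mul_inv_rev, Perm.mul_apply] using h2
  inv_mem' := by
    intro x hx k l a hl ha
    have hl' : x.right l ≠ x.right k := fun h => hl (x.right.injective h)
    have hb : circlePos n (x.right k) (x.right l) < n := by
      have := fun h => hl' (Fin.ext h)
      have := (x.right k).isLt
      have := (x.right l).isLt
      simp only [circlePos]; split_ifs <;> omega
    have h1 := hx (x.right k) (x.right l) ⟨_, hb⟩ hl' rfl
    have e : ∀ j, x.right⁻¹ (x.right j) = j := fun j => x.right.symm_apply_apply j
    rw [e, e, ← ha] at h1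
    have h2 := Fin.ext h1
    rw [Perm.inv_eq_iff_eq] at h2
    have h3 : x⁻¹.left k = (x.left (x.right k))⁻¹ := rfl
    rw [h3, map_inv, inv_inv, SemidirectProduct.inv_right, inv_inv, ← h2]

theorem cylPerm_σ (n i : ℕ) (hi : i < n - 1) : cylPerm n (CylBraidGroup.σ n i) = adjSwap n i :=
  CylBraidGroup.lift_σ _ _ _ _ _ i hi

theorem cylPerm_ζ (n : ℕ) : cylPerm n (CylBraidGroup.ζ n) = (finRotate n)⁻¹ :=
  CylBraidGroup.lift_ζ _ _ _ _ _

theorem cylPerm_Δc (n : ℕ) : cylPerm n (CylBraidGroup.Δc n) = prodTo (adjSwap n) (n - 1) := by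
  rw [CylBraidGroup.Δc, prodTo_map]
  unfold prodTo
  congr 1
  refine List.map_congr_left fun i hi => cylPerm_σ n i (by simpa using hi)

theorem trackedCrossing_mem (n i : ℕ) (hi : i < n) : trackedCrossing n i ∈ compatible n := by
  intro k l a hl ha
  have hl' : l.val ≠ k.val := fun h => hl (Fin.ext h)
  have hk := k.isLt
  have hll := l.isLt
  have haa := a.isLt
  simp only [trackedCrossing, adjSwap_inv, adjSwap_val (n + 1) i (by omega : i + 1 < n + 1)]
  obtain h | h | h | h : i + 1 < k.val ∨ k.val = i + 1 ∨ k.val = i ∨ k.val < i := by omega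
  · rw [crossingSeenFrom_left h, cylPerm_σ _ _ (by omega), adjSwap_inv,
      adjSwap_val _ _ (by omega), swapNat_of_ne (k := k.val) (by omega) (by omega), ha]
    simp only [circlePos, swapNat]; grind
  · rw [h, crossingSeenFrom_pred, map_inv, cylPerm_ζ, inv_inv, swapNat_succ]
    have hb : circlePos n i (swapNat i l.val) < n := by
      simp only [circlePos, swapNat]; grind
    suffices hs : (finRotate n)⁻¹ a = ⟨_, hb⟩ by rw [hs]
    rw [Perm.inv_eq_iff_eq]
    ext
    rw [finRotate_val, ha, h]
    simp only [circlePos, swapNat]; grind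
  · rw [h, crossingSeenFrom_self, map_inv, cylPerm_Δc, inv_inv, prodTo_adjSwap_val _ _ (by omega)]
    simp only [h, circlePos] at ha
    simp only [circlePos, swapNat]; grind
  · rw [crossingSeenFrom_right h, cylPerm_σ _ _ (by omega), adjSwap_inv,
      adjSwap_val _ _ (by omega), swapNat_of_ne (k := k.val) (by omega) (by omega), ha]
    simp only [circlePos, swapNat]; grind

theorem trackedBraid_mem (n : ℕ) (β : BraidGroup (n + 1)) : trackedBraid n β ∈ compatible n := by
  refine PresentedGroup.generated_by _ ((compatible n).comap (trackedBraid n)) (fun i => ?_) β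
  have := trackedCrossing_mem n i.val i.isLt
  simpa [trackedBraid, BraidGroup.lift, PresentedBy.lift_of] using this

theorem cylPerm_trackedBraid (n : ℕ) (k : Fin (n + 1)) (β : PureBraidGroup (n + 1)) :
    (trackedBraid n β).left k ∈ PureCylBraidGroup n := by
  have hβ : braidPerm (n + 1) β = 1 := β.2
  have hmem := trackedBraid_mem n β
  rw [PureCylBraidGroup, MonoidHom.mem_ker, ← inv_eq_one]
  ext a
  have hk := k.isLt
  have ha := a.isLt
  obtain ⟨l, hl, hal⟩ : ∃ l : Fin (n + 1), l ≠ k ∧ a.val = circlePos n k l := by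
    by_cases h : a.val < k.val
    · refine ⟨⟨k.val - 1 - a.val, by omega⟩, ?_, ?_⟩
      · simp only [ne_eq, Fin.ext_iff]; omega
      · simp only [circlePos]; split_ifs <;> omega
    · refine ⟨⟨n + k.val - a.val, by omega⟩, ?_, ?_⟩
      · simp only [ne_eq, Fin.ext_iff]; omega
      · simp only [circlePos]; split_ifs <;> omega
  have := hmem k l a hl hal
  simpa [trackedBraid_right, hβ, ← hal] using this

/-- The map `p_k : PB_{n+1} → CPB_n`: the braid of the directions from the strand `k` to the
other strands. -/
def p (n : ℕ) (k : Fin (n + 1)) : PureBraidGroup (n + 1) →* PureCylBraidGroup n where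
  toFun β := ⟨(trackedBraid n β).left k, cylPerm_trackedBraid n k β⟩
  map_one' := by ext; simp
  map_mul' β γ := by
    have hβ : braidPerm (n + 1) β = 1 := β.2
    ext
    simp [trackedBraid_right, hβ]

/-! ### The virtual cylindrical braid group -/

/-- Generators of the virtual cylindrical braid group: the classical crossings `σ i`, the
virtual crossings `τ i` and the rotation `ζ`. -/
inductive VCylGen (n : ℕ) : Type
  | σ (i : Fin (n - 1))
  | τ (i : Fin (n - 1))
  | ζ

/-- Relations of the virtual cylindrical braid group. -/
inductive VCylRel (n : ℕ) : FreeGroup (VCylGen n) → FreeGroup (VCylGen n) → Prop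
  | braid_σ (i j : Fin (n - 1)) (h : i.val + 1 = j.val) :
      VCylRel n (.of (.σ i) * .of (.σ j) * .of (.σ i)) (.of (.σ j) * .of (.σ i) * .of (.σ j))
  | comm_σ (i j : Fin (n - 1)) (h : i.val + 2 ≤ j.val) :
      VCylRel n (.of (.σ i) * .of (.σ j)) (.of (.σ j) * .of (.σ i))
  | braid_τ (i j : Fin (n - 1)) (h : i.val + 1 = j.val) :
      VCylRel n (.of (.τ i) * .of (.τ j) * .of (.τ i)) (.of (.τ j) * .of (.τ i) * .of (.τ j))
  | comm_τ (i j : Fin (n - 1)) (h : i.val + 2 ≤ j.val) :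
      VCylRel n (.of (.τ i) * .of (.τ j)) (.of (.τ j) * .of (.τ i))
  | sq_τ (i : Fin (n - 1)) : VCylRel n (.of (.τ i) * .of (.τ i)) 1
  | mixed (i j : Fin (n - 1)) (h : i.val + 1 = j.val) :
      VCylRel n (.of (.τ i) * .of (.τ j) * .of (.σ i)) (.of (.σ j) * .of (.τ i) * .of (.τ j))
  | comm_στ (i j : Fin (n - 1)) (h : i.val + 2 ≤ j.val ∨ j.val + 2 ≤ i.val) :
      VCylRel n (.of (.σ i) * .of (.τ j)) (.of (.τ j) * .of (.σ i))
  | rot_σ (i j : Fin (n - 1)) (h : i.val + 1 = j.val) :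
      VCylRel n (.of (.σ i) * .of .ζ) (.of .ζ * .of (.σ j))
  | wrap_σ (i j : Fin (n - 1)) (hi : i.val + 2 = n) (hj : j.val = 0) :
      VCylRel n (.of (.σ i) * (.of .ζ * .of .ζ)) ((.of .ζ * .of .ζ) * .of (.σ j))
  | rot_τ (i j : Fin (n - 1)) (h : i.val + 1 = j.val) :
      VCylRel n (.of (.τ i) * .of .ζ) (.of .ζ * .of (.τ j))
  | wrap_τ (i j : Fin (n - 1)) (hi : i.val + 2 = n) (hj : j.val = 0) :
      VCylRel n (.of (.τ i) * (.of .ζ * .of .ζ)) ((.of .ζ * .of .ζ) * .of (.τ j))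

/-- The virtual cylindrical braid group `VCB_n` on `n` strands. -/
abbrev VCylBraidGroup (n : ℕ) : Type := PresentedBy (VCylRel n)

/-- `y 0, …, y (N - 1)` are involutions that satisfy the mixed relations with
`x 0, …, x (N - 1)`. -/
structure IsMixed {G : Type*} [Group G] (N : ℕ) (x y : ℕ → G) : Prop where
  sq : ∀ i, i < N → y i * y i = 1
  mixed : ∀ i, i + 1 < N → y i * y (i + 1) * x i = x (i + 1) * y i * y (i + 1)
  comm : ∀ i j, i < N → j < N → i + 2 ≤ j ∨ j + 2 ≤ i → x i * y j = y j * x i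

/-- The homomorphism from `VCB_n` given by images of the generators. -/
def VCylBraidGroup.lift {G : Type*} [Group G] (n : ℕ) (x y : ℕ → G) (z : G)
    (hx : IsBraided (n - 1) x) (hy : IsBraided (n - 1) y) (hxy : IsMixed (n - 1) x y)
    (hxz : IsRotated n x z) (hyz : IsRotated n y z) : VCylBraidGroup n →* G :=
  PresentedBy.lift (fun | .σ i => x i.val | .τ i => y i.val | .ζ => z) (by
    intro a b hab
    cases hab with
    | braid_σ i j h => simpa [← h] using hx.braid i.val (by omega)
    | comm_σ i j h => simpa using hx.comm i.val j.val h j.isLt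
    | braid_τ i j h => simpa [← h] using hy.braid i.val (by omega)
    | comm_τ i j h => simpa using hy.comm i.val j.val h j.isLt
    | sq_τ i => simpa using hxy.sq i.val i.isLt
    | mixed i j h => simpa [← h] using hxy.mixed i.val (by omega)
    | comm_στ i j h => simpa using hxy.comm i.val j.val i.isLt j.isLt h
    | rot_σ i j h => simpa [← h] using hxz.rot i.val (by omega)
    | wrap_σ i j hi hj =>
      have := hxz.wrap (by omega)
      rw [show n - 2 = i.val by omega] at this
      simpa [hj] using this
    | rot_τ i j h => simpa [← h] using hyz.rot i.val (by omega)
    | wrap_τ i j hi hj =>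
      have := hyz.wrap (by omega)
      rw [show n - 2 = i.val by omega] at this
      simpa [hj] using this)

namespace VCylBraidGroup

/-- The classical crossing `σ i` in `VCB_n` (the identity if `i` is out of range). -/
def σ (n i : ℕ) : VCylBraidGroup n :=
  if h : i < n - 1 then PresentedGroup.of (.σ ⟨i, h⟩) else 1

/-- The virtual crossing `τ i` in `VCB_n` (the identity if `i` is out of range). -/
def τ (n i : ℕ) : VCylBraidGroup n :=
  if h : i < n - 1 then PresentedGroup.of (.τ ⟨i, h⟩) else 1

/-- The rotation `ζ` in `VCB_n`. -/
def ζ (n : ℕ) : VCylBraidGroup n := PresentedGroup.of .ζ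

/-- The element `Δ_v`, the product of all virtual crossings `τ i` in increasing order. -/
def Δv (n : ℕ) : VCylBraidGroup n := prodTo (τ n) (n - 1)

theorem braided_σ (n : ℕ) : IsBraided (n - 1) (σ n) where
  braid i h := by
    simpa [σ, h, show i < n - 1 by omega] using
      PresentedBy.eq_of_rel (VCylRel.braid_σ (n := n) ⟨i, by omega⟩ ⟨i + 1, h⟩ rfl)
  comm i j h hj := by
    simpa [σ, hj, show i < n - 1 by omega] using
      PresentedBy.eq_of_rel (VCylRel.comm_σ (n := n) ⟨i, by omega⟩ ⟨j, hj⟩ h)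

theorem braided_τ (n : ℕ) : IsBraided (n - 1) (τ n) where
  braid i h := by
    simpa [τ, h, show i < n - 1 by omega] using
      PresentedBy.eq_of_rel (VCylRel.braid_τ (n := n) ⟨i, by omega⟩ ⟨i + 1, h⟩ rfl)
  comm i j h hj := by
    simpa [τ, hj, show i < n - 1 by omega] using
      PresentedBy.eq_of_rel (VCylRel.comm_τ (n := n) ⟨i, by omega⟩ ⟨j, hj⟩ h)

theorem mixed (n : ℕ) : IsMixed (n - 1) (σ n) (τ n) where
  sq i h := by
    simpa [τ, h] using PresentedBy.eq_of_rel (VCylRel.sq_τ (n := n) ⟨i, h⟩)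
  mixed i h := by
    simpa [σ, τ, h, show i < n - 1 by omega] using
      PresentedBy.eq_of_rel (VCylRel.mixed (n := n) ⟨i, by omega⟩ ⟨i + 1, h⟩ rfl)
  comm i j hi hj h := by
    simpa [σ, τ, hi, hj] using
      PresentedBy.eq_of_rel (VCylRel.comm_στ (n := n) ⟨i, hi⟩ ⟨j, hj⟩ h)

theorem rotated_σ (n : ℕ) : IsRotated n (σ n) (ζ n) where
  rot i h := by
    simpa [σ, ζ, show i < n - 1 by omega, show i + 1 < n - 1 by omega] using
      PresentedBy.eq_of_rel (VCylRel.rot_σ (n := n) ⟨i, by omega⟩ ⟨i + 1, by omega⟩ rfl)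
  wrap h := by
    simpa [σ, ζ, show n - 2 < n - 1 by omega, show 0 < n - 1 by omega] using
      PresentedBy.eq_of_rel (VCylRel.wrap_σ (n := n) ⟨n - 2, by omega⟩ ⟨0, by omega⟩
        (by simp; omega) rfl)

theorem rotated_τ (n : ℕ) : IsRotated n (τ n) (ζ n) where
  rot i h := by
    simpa [τ, ζ, show i < n - 1 by omega, show i + 1 < n - 1 by omega] using
      PresentedBy.eq_of_rel (VCylRel.rot_τ (n := n) ⟨i, by omega⟩ ⟨i + 1, by omega⟩ rfl)
  wrap h := by
    simpa [τ, ζ, show n - 2 < n - 1 by omega, show 0 < n - 1 by omega] using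
      PresentedBy.eq_of_rel (VCylRel.wrap_τ (n := n) ⟨n - 2, by omega⟩ ⟨0, by omega⟩
        (by simp; omega) rfl)

end VCylBraidGroup

/-! ### The map `f_d` -/

theorem IsMixed.prodTo_mul {G : Type*} [Group G] {N : ℕ} {x y : ℕ → G} (h : IsMixed N x y)
    (j : ℕ) (hj : j ≤ N) (i : ℕ) (hi : i + 1 < j) :
    prodTo y j * x i = x (i + 1) * prodTo y j := by
  induction j with
  | zero => omega
  | succ j ih =>
    rcases Nat.lt_or_ge (i + 1) j with h' | h'
    · rw [prodTo_succ, mul_assoc, ← h.comm i j (by omega) (by omega) (by omega), ← mul_assoc,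
        ih (by omega) h', mul_assoc]
    · obtain rfl : j = i + 1 := by omega
      rw [prodTo_succ, prodTo_succ, mul_assoc, mul_assoc, ← mul_assoc (y i),
        h.mixed i (by omega), ← mul_assoc, ← mul_assoc, ← mul_assoc,
        prodTo_comm y i (x (i + 1))
          (fun l hl => (h.comm (i + 1) l (by omega) (by omega) (by omega)).symm)]
      simp only [mul_assoc]

theorem IsMixed.two_strands {G : Type*} [Group G] {N : ℕ} {x y : ℕ → G} (h : IsMixed N x y)
    (hy : IsBraided N y) (j : ℕ) (hj : j < N) :
    prodTo (fun i => y (i + 1)) j * prodTo y j * x j =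
      x 0 * (prodTo (fun i => y (i + 1)) j * prodTo y j) := by
  induction j with
  | zero => simp [prodTo]
  | succ j ih =>
    have h1 : y (j + 1) * y j * x (j + 1) = x j * (y (j + 1) * y j) := by
      have e1 := h.mixed j hj
      have e2 : (y j)⁻¹ = y j := inv_eq_of_mul_eq_one_left (h.sq j (by omega))
      have e3 : (y (j + 1))⁻¹ = y (j + 1) := inv_eq_of_mul_eq_one_left (h.sq (j + 1) hj)
      rw [mul_assoc] at e1
      have e4 : x (j + 1) = y j * (y (j + 1) * x j) * (y (j + 1))⁻¹ * (y j)⁻¹ := by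
        rw [e1]; simp only [mul_assoc, mul_inv_cancel, mul_one]
      rw [e4, e2, e3]
      have e5 := h.sq j (by omega)
      have e6 := h.sq (j + 1) hj
      calc _ = y (j + 1) * (y j * y j) * y (j + 1) * (x j * (y (j + 1) * y j)) := by
            simp only [mul_assoc]
        _ = _ := by rw [e5, mul_one, e6, one_mul]
    have h2 : prodTo y j * y (j + 1) = y (j + 1) * prodTo y j :=
      prodTo_comm y j _ (fun i hi => hy.comm i (j + 1) (by omega) hj)
    have e : prodTo (fun i => y (i + 1)) (j + 1) * prodTo y (j + 1) =
        prodTo (fun i => y (i + 1)) j * prodTo y j * (y (j + 1) * y j) := by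
      rw [prodTo_succ, prodTo_succ, mul_assoc, ← mul_assoc (y (j + 1)), ← h2]
      simp only [mul_assoc]
    rw [e, mul_assoc, h1, ← mul_assoc, ih (by omega)]
    simp only [mul_assoc]

theorem isRotated_cover {G : Type*} [Group G] {n : ℕ} {x y : ℕ → G} {z : G}
    (hy : IsBraided (n - 1) y) (hxy : IsMixed (n - 1) x y)
    (hxz : IsRotated n x z) (hyz : IsRotated n y z) (e : ℤ) :
    IsRotated n x (z * (prodTo y (n - 1) * z) ^ e) where
  rot i h := by
    have hc : Commute (x (i + 1)) (prodTo y (n - 1) * z) := by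
      show x (i + 1) * (prodTo y (n - 1) * z) = prodTo y (n - 1) * z * x (i + 1)
      rw [mul_assoc, ← hxz.rot i h, ← mul_assoc, ← mul_assoc,
        hxy.prodTo_mul (n - 1) le_rfl i (by omega)]
    rw [← mul_assoc, hxz.rot i h, mul_assoc, mul_assoc, (hc.zpow_right e).eq]
  wrap h := by
    obtain ⟨N, rfl⟩ : ∃ N, n = N + 2 := ⟨n - 2, by omega⟩
    simp only [show N + 2 - 1 = N + 1 by omega, show N + 2 - 2 = N by omega] at *
    have wx : x N * (z * z) = z * z * x 0 := hxz.wrap h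
    have wy : y N * (z * z) = z * z * y 0 := hyz.wrap h
    have hyy : IsMixed (N + 1) y y :=
      ⟨hxy.sq, fun i hi => hy.braid i hi, fun i j hi hj hij => hij.elim
        (fun h => hy.comm i j h hj) (fun h => (hy.comm j i h hi).symm)⟩
    set E := prodTo (fun i => y (i + 1)) N with hE
    set F := prodTo y N with hF
    have hzE : z * E = F * z := prodTo_shift _ _ _ _ (fun i hi => (hyz.rot i (by omega)).symm)
    have hA : prodTo y (N + 1) = y 0 * E := prodTo_succ' y N
    have hA' : prodTo y (N + 1) = F * y N := prodTo_succ y N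
    have hBB : E * z * (E * z) = E * F * (z * z) := by
      rw [mul_assoc, ← mul_assoc z, hzE]; simp only [mul_assoc]
    have hcx : Commute (x 0) (E * z * (E * z)) := by
      show x 0 * (E * z * (E * z)) = E * z * (E * z) * x 0
      rw [hBB, mul_assoc _ _ (x 0), ← wx, ← mul_assoc _ (x N), hxy.two_strands hy N (by omega)]
      simp only [mul_assoc, ← hE, ← hF]
    have hcy : Commute (y 0) (E * z * (E * z)) := by
      show y 0 * (E * z * (E * z)) = E * z * (E * z) * y 0
      rw [hBB, mul_assoc _ _ (y 0), ← wy, ← mul_assoc _ (y N), hyy.two_strands hy N (by omega)]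
      simp only [mul_assoc, ← hE, ← hF]
    have sq0 : y 0 * y 0 = 1 := hxy.sq 0 (by omega)
    set A := prodTo y (N + 1) * z with hAdef
    have hAB : A = y 0 * (E * z) := by rw [hAdef, hA, mul_assoc]
    set A2 := z⁻¹ * A * z with hA2def
    have hA2 : A2 = E * z * y 0 := by
      rw [hA2def, hAdef, hA', mul_assoc, inv_mul_eq_iff_eq_mul, ← mul_assoc, ← mul_assoc, hzE,
        mul_assoc, mul_assoc, wy]
      simp only [mul_assoc]
    have h21 : A2 * A = E * z * (E * z) := by
      rw [hA2, hAB, mul_assoc, ← mul_assoc (y 0), sq0, one_mul]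
    have hcomm : Commute A2 A := by
      show A2 * A = A * A2
      calc A2 * A = E * z * (E * z) * (y 0 * y 0) := by rw [h21, sq0, mul_one]
        _ = y 0 * (E * z * (E * z)) * y 0 := by rw [← mul_assoc, ← hcy.eq]
        _ = A * A2 := by rw [hA2, hAB]; simp only [mul_assoc]
    have hz : A ^ e * z = z * A2 ^ e := by
      have : A2 ^ e = z⁻¹ * A ^ e * z := by
        have := conj_zpow (i := e) (a := z⁻¹) (b := A)
        rwa [inv_inv] at this
      rw [this]; simp only [mul_assoc, mul_inv_cancel_left]
    have hzz : z * A ^ e * (z * A ^ e) = z * z * (E * z * (E * z)) ^ e := by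
      rw [← h21, hcomm.mul_zpow, mul_assoc, ← mul_assoc (A ^ e), hz]
      simp only [mul_assoc]
    rw [hzz, ← mul_assoc, wx, mul_assoc _ (x 0), (hcx.zpow_right e).eq, ← mul_assoc]

/-- The map `f_d` induced by `z ↦ z ^ d` on the circle, on the whole cylindrical braid group:
`σ i ↦ σ i` and `ζ ↦ ζ (Δ_v ζ) ^ (d - 1)`. -/
def fFull (n : ℕ) (d : ℤ) : CylBraidGroup n →* VCylBraidGroup n :=
  CylBraidGroup.lift n (VCylBraidGroup.σ n)
    (VCylBraidGroup.ζ n * (VCylBraidGroup.Δv n * VCylBraidGroup.ζ n) ^ (d - 1))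
    (VCylBraidGroup.braided_σ n)
    (isRotated_cover (VCylBraidGroup.braided_τ n) (VCylBraidGroup.mixed n)
      (VCylBraidGroup.rotated_σ n) (VCylBraidGroup.rotated_τ n) (d - 1))

/-- The map `f_d : CPB_n → VCB_n`. -/
def f (n : ℕ) (d : ℤ) : PureCylBraidGroup n →* VCylBraidGroup n :=
  (fFull n d).comp (PureCylBraidGroup n).subtype

/-! ### The representation `ρ` -/

noncomputable section

/-- The ring `ℤ[t^±1, s^±1]`, as Laurent polynomials in `s` over Laurent polynomials in `t`. -/
abbrev LaurentTS : Type := LaurentPolynomial (LaurentPolynomial ℤ)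

/-- The monomial `t ^ j`. -/
def tPow (j : ℤ) : LaurentTS := LaurentPolynomial.C (LaurentPolynomial.T j)

/-- The monomial `s ^ j`. -/
def sPow (j : ℤ) : LaurentTS := LaurentPolynomial.T j

theorem tPow_mul (i j : ℤ) (h : i + j = 0) : tPow i * tPow j = 1 := by
  rw [tPow, tPow, ← map_mul, ← LaurentPolynomial.T_add, h, LaurentPolynomial.T_zero, map_one]

theorem sPow_mul (i j : ℤ) (h : i + j = 0) : sPow i * sPow j = 1 := by
  rw [sPow, sPow, ← LaurentPolynomial.T_add, h, LaurentPolynomial.T_zero]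

section block

variable {R : Type*} [CommRing R]

/-- The block diagonal `n × n` matrix with blocks `I_i`, `!![a, b; c, d]`, `I_{n-i-2}`. -/
def blockMatrix (n i : ℕ) (a b c d : R) : Matrix (Fin n) (Fin n) R :=
  Matrix.of fun p q =>
    if p.val = i then (if q.val = i then a else if q.val = i + 1 then b else 0)
    else if p.val = i + 1 then (if q.val = i then c else if q.val = i + 1 then d else 0)
    else if p = q then 1 else 0

/-- The matrix with an identity block `I_{n-1}` in the upper right corner and an entry `1` in the
lower left corner. -/
def rotMatrix (R : Type*) [CommRing R] (n : ℕ) : Matrix (Fin n) (Fin n) R :=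
  Matrix.of fun p q =>
    if q.val = p.val + 1 ∨ (p.val + 1 = n ∧ q.val = 0) then 1 else 0

/-- The action of `blockMatrix` on sequences. -/
def blockAct (i : ℕ) (a b c d : R) (w : ℕ → R) (p : ℕ) : R :=
  if p = i then a * w i + b * w (i + 1)
  else if p = i + 1 then c * w i + d * w (i + 1) else w p

/-- The action of `rotMatrix` on sequences. -/
def rotAct (n : ℕ) (w : ℕ → R) (p : ℕ) : R := if p + 1 = n then w 0 else w (p + 1)

theorem blockMatrix_mulVec (n i : ℕ) (h : i + 1 < n) (a b c d : R) (w : ℕ → R) :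
    (blockMatrix n i a b c d).mulVec (fun q => w q.val) = fun p => blockAct i a b c d w p.val := by
  have key : ∀ α β : R, ∑ q : Fin n, (if q.val = i then α else if q.val = i + 1 then β else 0) *
      w q.val = α * w i + β * w (i + 1) := by
    intro α β
    rw [Finset.sum_eq_add (⟨i, by omega⟩ : Fin n) ⟨i + 1, h⟩ (by simp)]
    · simp
    · intro q _ hq
      have h1 : q.val ≠ i := fun e => hq.1 (Fin.ext e)
      have h2 : q.val ≠ i + 1 := fun e => hq.2 (Fin.ext e)
      simp [h1, h2]
    · simp
    · simp
  funext p
  simp only [Matrix.mulVec, dotProduct, blockMatrix, Matrix.of_apply, blockAct]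
  split_ifs with h1 h2
  · exact key a b
  · exact key c d
  · simp

theorem rotMatrix_mulVec (n : ℕ) (w : ℕ → R) :
    (rotMatrix R n).mulVec (fun q => w q.val) = fun p => rotAct n w p.val := by
  funext p
  have hp := p.isLt
  simp only [Matrix.mulVec, dotProduct, rotMatrix, Matrix.of_apply, rotAct]
  split_ifs with h1
  · rw [Finset.sum_eq_single (⟨0, by omega⟩ : Fin n)]
    · simp [h1]
    · intro q _ hq
      have h2 : q.val ≠ 0 := fun e => hq (Fin.ext e)
      have := q.isLt
      rw [if_neg (by omega), zero_mul]
    · simp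
  · rw [Finset.sum_eq_single (⟨p.val + 1, by omega⟩ : Fin n)]
    · simp
    · intro q _ hq
      have h2 : q.val ≠ p.val + 1 := fun e => hq (Fin.ext e)
      rw [if_neg (by omega), zero_mul]
    · simp

theorem rotMatrix_transpose_mulVec (n : ℕ) (w : ℕ → R) :
    (rotMatrix R n).transpose.mulVec (fun q => w q.val) =
      fun p => if p.val = 0 then w (n - 1) else w (p.val - 1) := by
  funext p
  have hp := p.isLt
  simp only [Matrix.mulVec, dotProduct, rotMatrix, Matrix.transpose_apply, Matrix.of_apply]
  split_ifs with h1
  · rw [Finset.sum_eq_single (⟨n - 1, by omega⟩ : Fin n)]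
    · rw [if_pos (by simp; omega), one_mul]
    · intro q _ hq
      have h2 : q.val ≠ n - 1 := fun e => hq (Fin.ext e)
      have := q.isLt
      rw [if_neg (by omega), zero_mul]
    · simp
  · rw [Finset.sum_eq_single (⟨p.val - 1, by omega⟩ : Fin n)]
    · rw [if_pos (by simp; omega), one_mul]
    · intro q _ hq
      have h2 : q.val ≠ p.val - 1 := fun e => hq (Fin.ext e)
      rw [if_neg (by omega), zero_mul]
    · simp

theorem matrix_ext_seq {n : ℕ} {A B : Matrix (Fin n) (Fin n) R}
    (h : ∀ w : ℕ → R, A.mulVec (fun q => w q.val) = B.mulVec (fun q => w q.val)) : A = B := by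
  apply Matrix.mulVec_injective
  funext v
  have := h (fun j => if hj : j < n then v ⟨j, hj⟩ else 0)
  simpa using this

theorem blockMatrix_mul (n i : ℕ) (h : i + 1 < n) (a b c d a' b' c' d' : R)
    (h1 : a * a' + b * c' = 1) (h2 : a * b' + b * d' = 0) (h3 : c * a' + d * c' = 0)
    (h4 : c * b' + d * d' = 1) : blockMatrix n i a b c d * blockMatrix n i a' b' c' d' = 1 := by
  refine matrix_ext_seq fun w => ?_
  rw [← Matrix.mulVec_mulVec, blockMatrix_mulVec n i h, blockMatrix_mulVec n i h, Matrix.one_mulVec]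
  funext p
  simp only [blockAct]
  grind

theorem rotMatrix_mul_transpose (n : ℕ) : rotMatrix R n * (rotMatrix R n).transpose = 1 := by
  refine matrix_ext_seq fun w => ?_
  rw [← Matrix.mulVec_mulVec, rotMatrix_transpose_mulVec,
    rotMatrix_mulVec n (fun p => if p = 0 then w (n - 1) else w (p - 1)), Matrix.one_mulVec]
  funext p
  simp only [rotAct]
  grind

variable (i : ℕ) (a b c d : R) (w : ℕ → R)

theorem blockAct_comm (j : ℕ) (a' b' c' d' : R) (h : i + 2 ≤ j) (p : ℕ) :
    blockAct i a b c d (blockAct j a' b' c' d' w) p =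
      blockAct j a' b' c' d' (blockAct i a b c d w) p := by
  simp only [blockAct]
  grind

theorem blockAct_rot (n : ℕ) (h : i + 2 < n) (p : ℕ) :
    blockAct i a b c d (rotAct n w) p = rotAct n (blockAct (i + 1) a b c d w) p := by
  simp only [blockAct, rotAct]
  grind

theorem blockAct_wrap (n : ℕ) (h : 2 ≤ n) (p : ℕ) (hp : p < n) :
    blockAct (n - 2) a b c d (rotAct n (rotAct n w)) p =
      rotAct n (rotAct n (blockAct 0 a b c d w)) p := by
  simp only [blockAct, rotAct]
  grind

theorem blockAct_braid_t (t : R) (p : ℕ) :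
    blockAct i (1 - t) t 1 0 (blockAct (i + 1) (1 - t) t 1 0 (blockAct i (1 - t) t 1 0 w)) p =
    blockAct (i + 1) (1 - t) t 1 0
      (blockAct i (1 - t) t 1 0 (blockAct (i + 1) (1 - t) t 1 0 w)) p := by
  simp only [blockAct]
  grind

theorem blockAct_braid_s (s s' : R) (p : ℕ) :
    blockAct i 0 s s' 0 (blockAct (i + 1) 0 s s' 0 (blockAct i 0 s s' 0 w)) p =
    blockAct (i + 1) 0 s s' 0 (blockAct i 0 s s' 0 (blockAct (i + 1) 0 s s' 0 w)) p := by
  simp only [blockAct]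
  grind

theorem blockAct_mixed (t s s' : R) (p : ℕ) :
    blockAct i 0 s s' 0 (blockAct (i + 1) 0 s s' 0 (blockAct i (1 - t) t 1 0 w)) p =
    blockAct (i + 1) (1 - t) t 1 0 (blockAct i 0 s s' 0 (blockAct (i + 1) 0 s s' 0 w)) p := by
  simp only [blockAct]
  grind
end block

/-- The matrix `ρ(σ i)`, with its inverse (the identity if `i` is out of range). -/
def rhoσ (n i : ℕ) : GL (Fin n) LaurentTS :=
  if h : i + 1 < n then
    ⟨blockMatrix n i (1 - tPow 1) (tPow 1) 1 0, blockMatrix n i 0 1 (tPow (-1)) (1 - tPow (-1)),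
      blockMatrix_mul n i h _ _ _ _ _ _ _ _
        (by linear_combination tPow_mul 1 (-1) (by norm_num))
        (by linear_combination -tPow_mul 1 (-1) (by norm_num)) (by ring) (by ring),
      blockMatrix_mul n i h _ _ _ _ _ _ _ _ (by ring) (by ring)
        (by linear_combination -tPow_mul 1 (-1) (by norm_num))
        (by linear_combination tPow_mul 1 (-1) (by norm_num))⟩
  else 1

/-- The matrix `ρ(τ i)`, with its inverse (the identity if `i` is out of range). -/
def rhoτ (n i : ℕ) : GL (Fin n) LaurentTS :=
  if h : i + 1 < n then
    ⟨blockMatrix n i 0 (sPow 1) (sPow (-1)) 0, blockMatrix n i 0 (sPow 1) (sPow (-1)) 0,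
      blockMatrix_mul n i h _ _ _ _ _ _ _ _
        (by linear_combination sPow_mul 1 (-1) (by norm_num)) (by ring) (by ring)
        (by linear_combination sPow_mul 1 (-1) (by norm_num)),
      blockMatrix_mul n i h _ _ _ _ _ _ _ _
        (by linear_combination sPow_mul 1 (-1) (by norm_num)) (by ring) (by ring)
        (by linear_combination sPow_mul 1 (-1) (by norm_num))⟩
  else 1

/-- The matrix `ρ(ζ)`, with its inverse. -/
def rhoζ (n : ℕ) : GL (Fin n) LaurentTS :=
  ⟨rotMatrix LaurentTS n, (rotMatrix LaurentTS n).transpose, rotMatrix_mul_transpose n,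
    mul_eq_one_comm.1 (rotMatrix_mul_transpose n)⟩

theorem rhoσ_mulVec (n i : ℕ) (h : i + 1 < n) (w : ℕ → LaurentTS) :
    (rhoσ n i).val.mulVec (fun q => w q.val) =
      fun p => blockAct i (1 - tPow 1) (tPow 1) 1 0 w p.val := by
  rw [rhoσ, dif_pos h]; exact blockMatrix_mulVec n i h _ _ _ _ w

theorem rhoτ_mulVec (n i : ℕ) (h : i + 1 < n) (w : ℕ → LaurentTS) :
    (rhoτ n i).val.mulVec (fun q => w q.val) =
      fun p => blockAct i 0 (sPow 1) (sPow (-1)) 0 w p.val := by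
  rw [rhoτ, dif_pos h]; exact blockMatrix_mulVec n i h _ _ _ _ w

theorem rhoζ_mulVec (n : ℕ) (w : ℕ → LaurentTS) :
    (rhoζ n).val.mulVec (fun q => w q.val) = fun p => rotAct n w p.val :=
  rotMatrix_mulVec n w

theorem gl_ext_seq {n : ℕ} {A B : GL (Fin n) LaurentTS}
    (h : ∀ w : ℕ → LaurentTS,
      A.val.mulVec (fun q => w q.val) = B.val.mulVec (fun q => w q.val)) : A = B :=
  Units.ext (matrix_ext_seq h)

theorem rhoσ_braided (n : ℕ) : IsBraided (n - 1) (rhoσ n) where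
  braid i h := by
    refine gl_ext_seq fun w => ?_
    simp only [Units.val_mul, ← Matrix.mulVec_mulVec,
      rhoσ_mulVec n i (by omega), rhoσ_mulVec n (i + 1) (by omega)]
    funext p
    exact blockAct_braid_t i w _ p.val
  comm i j h hj := by
    refine gl_ext_seq fun w => ?_
    simp only [Units.val_mul, ← Matrix.mulVec_mulVec,
      rhoσ_mulVec n i (by omega), rhoσ_mulVec n j (by omega)]
    funext p
    exact blockAct_comm i _ _ _ _ w j _ _ _ _ h p.val

theorem rhoσ_rotated (n : ℕ) : IsRotated n (rhoσ n) (rhoζ n) where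
  rot i h := by
    refine gl_ext_seq fun w => ?_
    simp only [Units.val_mul, ← Matrix.mulVec_mulVec,
      rhoσ_mulVec n i (by omega), rhoσ_mulVec n (i + 1) (by omega), rhoζ_mulVec]
    funext p
    exact blockAct_rot i _ _ _ _ w n h p.val
  wrap h := by
    refine gl_ext_seq fun w => ?_
    simp only [Units.val_mul, ← Matrix.mulVec_mulVec,
      rhoσ_mulVec n (n - 2) (by omega), rhoσ_mulVec n 0 (by omega), rhoζ_mulVec]
    funext p
    exact blockAct_wrap _ _ _ _ w n h p.val p.isLt

theorem rhoτ_braided (n : ℕ) : IsBraided (n - 1) (rhoτ n) where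
  braid i h := by
    refine gl_ext_seq fun w => ?_
    simp only [Units.val_mul, ← Matrix.mulVec_mulVec,
      rhoτ_mulVec n i (by omega), rhoτ_mulVec n (i + 1) (by omega)]
    funext p
    exact blockAct_braid_s i w _ _ p.val
  comm i j h hj := by
    refine gl_ext_seq fun w => ?_
    simp only [Units.val_mul, ← Matrix.mulVec_mulVec,
      rhoτ_mulVec n i (by omega), rhoτ_mulVec n j (by omega)]
    funext p
    exact blockAct_comm i _ _ _ _ w j _ _ _ _ h p.val

theorem rhoτ_rotated (n : ℕ) : IsRotated n (rhoτ n) (rhoζ n) where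
  rot i h := by
    refine gl_ext_seq fun w => ?_
    simp only [Units.val_mul, ← Matrix.mulVec_mulVec,
      rhoτ_mulVec n i (by omega), rhoτ_mulVec n (i + 1) (by omega), rhoζ_mulVec]
    funext p
    exact blockAct_rot i _ _ _ _ w n h p.val
  wrap h := by
    refine gl_ext_seq fun w => ?_
    simp only [Units.val_mul, ← Matrix.mulVec_mulVec,
      rhoτ_mulVec n (n - 2) (by omega), rhoτ_mulVec n 0 (by omega), rhoζ_mulVec]
    funext p
    exact blockAct_wrap _ _ _ _ w n h p.val p.isLt

theorem rho_mixed (n : ℕ) : IsMixed (n - 1) (rhoσ n) (rhoτ n) where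
  sq i h := by
    have h' : i + 1 < n := by omega
    rw [rhoτ, dif_pos h']
    exact Units.ext (blockMatrix_mul n i h' _ _ _ _ _ _ _ _
      (by linear_combination sPow_mul 1 (-1) (by norm_num)) (by ring) (by ring)
      (by linear_combination sPow_mul 1 (-1) (by norm_num)))
  mixed i h := by
    refine gl_ext_seq fun w => ?_
    simp only [Units.val_mul, ← Matrix.mulVec_mulVec,
      rhoσ_mulVec n i (by omega), rhoσ_mulVec n (i + 1) (by omega),
      rhoτ_mulVec n i (by omega), rhoτ_mulVec n (i + 1) (by omega)]
    funext p
    exact blockAct_mixed i w _ _ _ p.val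
  comm i j hi hj h := by
    refine gl_ext_seq fun w => ?_
    simp only [Units.val_mul, ← Matrix.mulVec_mulVec,
      rhoσ_mulVec n i (by omega), rhoτ_mulVec n j (by omega)]
    funext p
    rcases h with h | h
    · exact blockAct_comm i _ _ _ _ w j _ _ _ _ h p.val
    · exact (blockAct_comm j _ _ _ _ w i _ _ _ _ h p.val).symm

/-- The representation `ρ : VCB_n → GL_n(ℤ[t^±1, s^±1])`. -/
def rho (n : ℕ) : VCylBraidGroup n →* GL (Fin n) LaurentTS :=
  VCylBraidGroup.lift n (rhoσ n) (rhoτ n) (rhoζ n) (rhoσ_braided n) (rhoτ_braided n)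
    (rho_mixed n) (rhoσ_rotated n) (rhoτ_rotated n)

/-- The Manturov–Nikonov map `ρ ∘ f_d ∘ p_k : PB_{n+1} → GL_n(ℤ[t^±1, s^±1])`. -/
def mnMap (n : ℕ) (d : ℤ) (k : Fin (n + 1)) : PureBraidGroup (n + 1) →* GL (Fin n) LaurentTS :=
  (rho n).comp ((f n d).comp (p n k))

end

end ManturovNikonov

namespace ManturovNikonov

open Equiv

/-! The full twist of `B_{n+1}` lies in the kernel. Geometrically it is a rigid rotation of all
strands by one full turn, so the directions from any chosen strand to the others also turn rigidly
once. The associated cylindrical braid is therefore a power `ζ ^ (±n)` of the rotation. Now `f_1`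
sends `ζ` to `ζ`, and `ρ(ζ)` is the matrix of an `n`-cycle, so `ρ(ζ) ^ n = 1` (`rhoζ_pow`). The full
twist itself is nontrivial, because its exponent sum `n (n - 1) + 2 n` is positive
(`fullTwist_ne_one`).

The predicate `Tracks` makes the geometric claim computable: it follows one strand through a word
and multiplies the cylindrical letters seen from it. For the first strand, a word for the full twist
is chosen whose contributions are `Δc ^ n`, then `Δc⁻¹ ^ n`, then `ζ⁻¹ ^ n`, so that the first two
cancel (`tracks_fullTwist`).

For an arbitrary `k`, the full twist is conjugated by a braid `γ` that takes the position `k` to the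
first one. Since the full twist is central the conjugate is the same braid, but centrality is not
needed: a conjugate of a nontrivial element is nontrivial, and the cylindrical braid only changes to
`x ζ⁻ⁿ x⁻¹`, whose image is still `1`. Purity of the conjugate follows from purity of this
cylindrical braid (`Tracks.mem_pure`). -/

/-- The Artin generator `σ i` of `B_{n+1}` (the identity if `i` is out of range). -/
def braidGen (n i : ℕ) : BraidGroup (n + 1) :=
  if h : i < n then PresentedGroup.of (⟨i, h⟩ : Fin (n + 1 - 1)) else 1

theorem lift_braidGen {G : Type*} [Group G] {n : ℕ} (s : ℕ → G) (hs : IsBraided n s) {i : ℕ}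
    (hi : i < n) : BraidGroup.lift (n + 1) s hs (braidGen n i) = s i := by
  simp [braidGen, hi, BraidGroup.lift, PresentedBy.lift_of]

/-- The exponent sum of a braid. -/
def exponentSum (n : ℕ) : BraidGroup (n + 1) →* Multiplicative ℤ :=
  BraidGroup.lift (n + 1) (fun _ => Multiplicative.ofAdd 1)
    ⟨fun _ _ => rfl, fun _ _ _ _ => rfl⟩

/-! ### Following one strand through a braid word -/

/-- The strand of `β` that starts at `k` ends at `l`, and the other strands describe the
cylindrical braid `x` around it. -/
structure Tracks {n : ℕ} (β : BraidGroup (n + 1)) (k l : Fin (n + 1)) (x : CylBraidGroup n) :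
    Prop where
  right : (trackedBraid n β).right⁻¹ k = l
  left : (trackedBraid n β).left k = x

namespace Tracks

variable {n : ℕ} {β γ : BraidGroup (n + 1)} {k l m : Fin (n + 1)} {x y : CylBraidGroup n}

theorem one : Tracks (1 : BraidGroup (n + 1)) k k 1 := ⟨by simp, by simp⟩

/-- In the semidirect product the second family is evaluated at the position where the strand of the
first braid ends. Matching endpoints turns this twisted multiplication into an ordinary product in
`CB_n`. -/
theorem mul (h : Tracks β k l x) (h' : Tracks γ l m y) : Tracks (β * γ) k m (x * y) where
  right := by
    rw [map_mul, SemidirectProduct.mul_right, mul_inv_rev, Perm.mul_apply, h.right, h'.right]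
  left := by
    rw [map_mul, SemidirectProduct.mul_left, Pi.mul_apply, mulAutArrow_perm_apply, h.right,
      h.left, h'.left]

theorem inv (h : Tracks β k l x) : Tracks β⁻¹ l k x⁻¹ where
  right := by
    rw [map_inv, SemidirectProduct.inv_right, inv_inv, ← h.right]
    exact Equiv.apply_symm_apply _ _
  left := by
    have h1 : (trackedBraid n β).right l = k := by
      rw [← h.right]; exact Equiv.apply_symm_apply _ _
    -- The inverse of `(F, s)` has the family `s⁻¹ • F⁻¹`, whose value at `l` is `(F (s l))⁻¹`; here
    -- `s l = k`.
    have h2 : (trackedBraid n β)⁻¹.left l =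
      ((trackedBraid n β).left ((trackedBraid n β).right l))⁻¹ := rfl
    rw [map_inv, h2, h1, h.left]

theorem pow (h : Tracks β k k x) (j : ℕ) : Tracks (β ^ j) k k (x ^ j) := by
  induction j with
  | zero => simpa using one
  | succ j ih => rw [pow_succ, pow_succ]; exact ih.mul h

/-- A crossing's permutation is an involution, so the inverse in `Tracks.right` disappears. The end
position is prescribed as a natural number so that the `swapNat` lemmas decide it. -/
theorem gen {i : ℕ} (hi : i < n) (h : l.val = swapNat i k.val) :
    Tracks (braidGen n i) k l (crossingSeenFrom n i k.val) := by
  have e : trackedBraid n (braidGen n i) = trackedCrossing n i :=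
    lift_braidGen _ (trackedCrossing_braided n) hi
  refine ⟨?_, by rw [e]; rfl⟩
  rw [e, trackedCrossing, adjSwap_inv]
  exact Fin.ext ((adjSwap_val _ _ (by omega) _).trans h.symm)

/-- The first strand passing in front of the next `j` ones. -/
theorem prodTo_gen (j : ℕ) (hj : j < n + 1) :
    Tracks (prodTo (braidGen n) j) 0 ⟨j, hj⟩ ((CylBraidGroup.Δc n)⁻¹ ^ j) := by
  induction j with
  | zero => simpa [prodTo] using one
  | succ j ih =>
    rw [prodTo_succ, pow_succ]
    refine (ih (by omega)).mul ?_
    -- The followed strand is now at position `j`, the left end of the crossing `j`, which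
    -- contributes `Δc⁻¹`.
    have := gen (n := n) (k := ⟨j, by omega⟩) (l := ⟨j + 1, hj⟩) (i := j) (by omega)
      swapNat_self.symm
    rwa [crossingSeenFrom_self] at this

/-- The strand at position `j` returning to the first position. -/
theorem prodTo_gen_reverse (j : ℕ) (hj : j < n + 1) :
    Tracks (prodTo (fun i => braidGen n (j - 1 - i)) j) ⟨j, hj⟩ 0
      ((CylBraidGroup.ζ n)⁻¹ ^ j) := by
  induction j with
  | zero => simpa [prodTo] using one
  | succ j ih =>
    -- The induction peels off the first letter: the crossing `j` moves the strand from `j + 1` to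
    -- `j`, contributing `ζ⁻¹`, and the remaining letters form the word for `j`.
    rw [prodTo_succ', pow_succ']
    have h := gen (n := n) (k := ⟨j + 1, hj⟩) (l := ⟨j, by omega⟩) (i := j) (by omega)
      swapNat_succ.symm
    rw [crossingSeenFrom_pred] at h
    have e : (fun i => braidGen n (j + 1 - 1 - (i + 1))) = fun i => braidGen n (j - 1 - i) := by
      funext i; congr 1; omega
    rw [e]
    exact h.mul (ih (by omega))

/-- Crossings away from the first strand are seen from it in reverse order. -/
theorem prodTo_gen_rest (j : ℕ) (hj : j ≤ n - 1) :
    Tracks (prodTo (fun i => braidGen n (n - 1 - i)) j) 0 0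
      (prodTo (CylBraidGroup.σ n) j) := by
  induction j with
  | zero => simpa [prodTo] using one
  | succ j ih =>
    rw [prodTo_succ, prodTo_succ]
    refine (ih (by omega)).mul ?_
    -- Since `j + 1 ≤ n - 1`, the crossing `n - 1 - j` has positive index and does not touch
    -- position `0`. Seen from there its index is `n + 0 - (n - 1 - j) - 1 = j`.
    have h := gen (n := n) (k := 0) (l := 0) (i := n - 1 - j) (by omega)
      (swapNat_of_ne (by simp; omega) (by simp)).symm
    rw [crossingSeenFrom_right (by simp; omega)] at h
    convert h using 2
    simp; omega

/-- A braid whose cylindrical braid around a closed strand is pure, is pure. -/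
theorem mem_pure (h : Tracks β k k x) (hx : x ∈ PureCylBraidGroup n) :
    β ∈ PureBraidGroup (n + 1) := by
  rw [PureBraidGroup, MonoidHom.mem_ker, ← trackedBraid_right, ← inv_eq_one]
  ext l
  have hx' : cylPerm n x = 1 := hx
  by_cases hl : l = k
  · rw [hl, h.right]; rfl
  -- The end position of another strand must differ from `k`, since `circlePos n k` is meaningful,
  -- and injective, only away from `k`.
  have hl' : (trackedBraid n β).right⁻¹ l ≠ k := by
    intro e
    exact hl ((trackedBraid n β).right⁻¹.injective (e.trans h.right.symm))
  have hk := k.isLt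
  have hll := l.isLt
  have hlt := ((trackedBraid n β).right⁻¹ l).isLt
  have hv : l.val ≠ k.val := fun e => hl (Fin.ext e)
  have hv' : ((trackedBraid n β).right⁻¹ l).val ≠ k.val := fun e => hl' (Fin.ext e)
  -- Membership in `compatible` says that the cylindrical permutation carries the circle position of
  -- the start of the strand to that of its end. As this permutation is trivial, the two circle
  -- positions agree. Positions left of `k` occupy circle positions below `k` and the others those
  -- from `k` on, so the strand ends where it started.
  have := trackedBraid_mem n β k l
    ⟨circlePos n k l, by simp only [circlePos]; split_ifs <;> omega⟩ hl rfl
  rw [h.left, h.right, hx', inv_one, Perm.one_apply] at this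
  simp only [circlePos] at this
  rw [Perm.one_apply]
  split_ifs at this <;> omega

end Tracks

/-! ### The full twist: its cylindrical braid and its nontriviality -/

/-- The full twist on `n + 1` strands: the last `n` strands make a full twist, then the first
strand winds once around them. -/
def fullTwist (n : ℕ) : BraidGroup (n + 1) :=
  prodTo (fun i => braidGen n (n - 1 - i)) (n - 1) ^ n *
    (prodTo (braidGen n) n * prodTo (fun i => braidGen n (n - 1 - i)) n)

/-- The twist of the last `n` strands is seen from the first strand as `Δc ^ n`. The first strand
passing in front of the others undoes exactly this, and its way back leaves `ζ⁻¹ ^ n`. -/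
theorem tracks_fullTwist (n : ℕ) : Tracks (fullTwist n) 0 0 ((CylBraidGroup.ζ n)⁻¹ ^ n) := by
  have h := ((Tracks.prodTo_gen_rest (n := n) (n - 1) le_rfl).pow n).mul
    ((Tracks.prodTo_gen n (by omega)).mul (Tracks.prodTo_gen_reverse n (by omega)))
  have e : prodTo (CylBraidGroup.σ n) (n - 1) = CylBraidGroup.Δc n := rfl
  rwa [e, inv_pow (CylBraidGroup.Δc n), mul_inv_cancel_left] at h

theorem exponentSum_prodTo {n : ℕ} (s : ℕ → BraidGroup (n + 1)) (j : ℕ)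
    (h : ∀ i < j, exponentSum n (s i) = Multiplicative.ofAdd 1) :
    exponentSum n (prodTo s j) = Multiplicative.ofAdd (j : ℤ) := by
  induction j with
  | zero => simp [prodTo]
  | succ j ih =>
    rw [prodTo_succ, map_mul, ih (fun i hi => h i (by omega)), h j (by omega), ← ofAdd_add]
    simp

/-- Every letter of the word is a positive generator, so the exponent sum is its length `n (n - 1) +
2 n`, which is positive. -/
theorem fullTwist_ne_one {n : ℕ} (hn : 1 ≤ n) : fullTwist n ≠ 1 := by
  intro h
  have hg : ∀ i < n, exponentSum n (braidGen n i) = Multiplicative.ofAdd 1 :=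
    fun i hi => lift_braidGen _ _ hi
  have h1 := congrArg (exponentSum n) h
  rw [fullTwist, map_mul, map_mul, map_pow, exponentSum_prodTo _ n hg,
    exponentSum_prodTo _ n (fun i hi => hg _ (by omega)),
    exponentSum_prodTo _ (n - 1) (fun i hi => hg _ (by omega)), map_one, ← ofAdd_nsmul,
    ← ofAdd_add, ← ofAdd_add, ofAdd_eq_one, nsmul_eq_mul] at h1
  -- The product is nonlinear, so its sign is supplied separately; the two remaining summands `n`
  -- are then enough for `omega`.
  have : (0 : ℤ) ≤ (n : ℤ) * ((n - 1 : ℕ) : ℤ) := by positivity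
  omega

/-! ### The `n`-th power of the rotation, as a permutation and as a matrix -/

theorem finRotate_pow_val (n j : ℕ) (a : Fin n) :
    ((finRotate n ^ j) a).val = (a.val + j) % n := by
  induction j with
  | zero => simp [Nat.mod_eq_of_lt a.isLt]
  | succ j ih =>
    have hlt := Nat.mod_lt (a.val + j) (show 0 < n by omega)
    have e : (a.val + (j + 1)) % n = ((a.val + j) % n + 1) % n := by
      rw [Nat.mod_add_mod, Nat.add_assoc]
    rw [pow_succ', Perm.mul_apply, finRotate_val, ih, e]
    split_ifs with h
    · rw [h, Nat.mod_self]
    · exact (Nat.mod_eq_of_lt (by omega)).symm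

theorem ζ_inv_pow_mem_pure (n : ℕ) : (CylBraidGroup.ζ n)⁻¹ ^ n ∈ PureCylBraidGroup n := by
  rw [PureCylBraidGroup, MonoidHom.mem_ker, map_pow, map_inv, cylPerm_ζ, inv_inv]
  ext a
  rw [finRotate_pow_val]
  simp [Nat.mod_eq_of_lt a.isLt]

/-- Each factor shifts the indices cyclically by one, so powers add up to a shift modulo `n`. -/
theorem rotMatrix_pow_mulVec {R : Type*} [CommRing R] (n j : ℕ) (w : ℕ → R) :
    (rotMatrix R n ^ j).mulVec (fun q => w q.val) = fun p => w ((p.val + j) % n) := by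
  induction j with
  | zero => funext p; simp [Nat.mod_eq_of_lt p.isLt]
  | succ j ih =>
    -- The shifted vector is presented as the restriction of a sequence on all of `ℕ`, the form that
    -- `rotMatrix_mulVec` expects.
    rw [pow_succ', ← Matrix.mulVec_mulVec, ih, rotMatrix_mulVec n (fun p => w ((p + j) % n))]
    funext p
    simp only [rotAct]
    split_ifs with h
    -- In the last row the rotation reads entry `0`; since `p + 1 = n`, the index `p + j + 1`
    -- exceeds `0 + j` by exactly `n`.
    · rw [show p.val + (j + 1) = 0 + j + n by omega, Nat.add_mod_right]
    · rw [show p.val + (j + 1) = p.val + 1 + j by omega]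

theorem rhoζ_pow (n : ℕ) : rhoζ n ^ n = 1 := by
  refine Units.ext (matrix_ext_seq fun w => ?_)
  rw [Units.val_pow_eq_pow_val, Units.val_one, Matrix.one_mulVec]
  refine (rotMatrix_pow_mulVec n n w).trans ?_
  funext p
  simp [Nat.mod_eq_of_lt p.isLt]

theorem fFull_one_ζ (n : ℕ) : fFull n 1 (CylBraidGroup.ζ n) = VCylBraidGroup.ζ n := by
  refine (CylBraidGroup.lift_ζ _ _ _ _ _).trans ?_
  -- For `d = 1` the exponent `d - 1` of `Δ_v ζ` is zero, so no virtual correction remains.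
  simp

theorem rho_ζ (n : ℕ) : rho n (VCylBraidGroup.ζ n) = rhoζ n := by
  simp [rho, VCylBraidGroup.lift, VCylBraidGroup.ζ, PresentedBy.lift_of]

/-- This is the source of non-injectivity: `ζ` has infinite order in `CB_n` (send `ζ` to `1` and
every `σ i` to `0` in `ℤ`), but its matrix has finite order. -/
theorem rho_fFull_ζ_inv_pow (n : ℕ) : rho n (fFull n 1 ((CylBraidGroup.ζ n)⁻¹ ^ n)) = 1 := by
  rw [map_pow, map_pow, map_inv, map_inv, fFull_one_ζ, rho_ζ, inv_pow, rhoζ_pow, inv_one]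

/-! ### Transport to an arbitrary strand and conclusion -/

/-- A braid from the position `k` to the first position. -/
theorem exists_tracks_zero {n : ℕ} (k : Fin (n + 1)) : ∃ γ x, Tracks (n := n) γ k 0 x :=
  ⟨_, _, Tracks.prodTo_gen_reverse k.val k.isLt⟩

end ManturovNikonov

open ManturovNikonov in
theorem theorem2 (m n : ℕ) (hm : 1 ≤ m) (hn : n = 2 * m) (k : Fin (n + 1)) :
    ¬ Function.Injective (ManturovNikonov.mnMap n 1 k) := by
  intro hinj
  obtain ⟨γ, x, hγ⟩ := exists_tracks_zero k
  -- The path goes from `k` to the first position along `γ`, around the full twist, and back; the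
  -- cylindrical braid is `x * ζ⁻¹ ^ n * x⁻¹`.
  have ht := (hγ.mul (tracks_fullTwist n)).mul hγ.inv
  -- The element `x` need not be pure, but `CPB_n` is a kernel and hence normal.
  have hp : γ * fullTwist n * γ⁻¹ ∈ PureBraidGroup (n + 1) :=
    ht.mem_pure ((MonoidHom.normal_ker (cylPerm n)).conj_mem _ (ζ_inv_pow_mem_pure n) x)
  have h1 : mnMap n 1 k ⟨_, hp⟩ = 1 := by
    -- Passing from `f` to `fFull` allows the product to be split, since `fFull` is defined on all
    -- of `CB_n` and hence also on `x`.
    change rho n (fFull n 1 ((trackedBraid n (γ * fullTwist n * γ⁻¹)).left k)) = 1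
    rw [ht.left, map_mul, map_mul, map_mul, map_mul, rho_fFull_ζ_inv_pow, mul_one, ← map_mul,
      ← map_mul, mul_inv_cancel, map_one, map_one]
  have h2 := congrArg Subtype.val (hinj (h1.trans (map_one _).symm))
  exact fullTwist_ne_one (show 1 ≤ n by omega) (conj_eq_one_iff.1 h2)
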